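/- **Theorem 5.9.** All rings and modules are associative but not necessarily unital. For a ring $R$, let $R\text{-}{}^{n}\mathrm{Mod}$ be the abelian category of nonunital left $R$-modules (abelian groups with a biadditive associative action of $R$), and let $R\otimes_R M$ be the quotient of $R\otimes_{\mathbb Z}M$ by the relations $ar\otimes m=a\otimes rm$, with $r(a\otimes m)=ra\otimes m$. Let $\mathrm{Hom}_R(R,P)$ be the group of left $R$-module maps $R\to P$, with $(rf)(s)=f(sr)$. A left $R$-module $M$ is *t-unital* if the natural map $R\otimes_R M\to M$, $r\otimes m\mapsto rm$, is an isomorphism; a left $R$-module $P$ is *c-unital* if the natural map $P\to\mathrm{Hom}_R(R,P)$, $p\mapsto(r\mapsto rp)$, is an isomorphism; a module is a *null-module* if $R$ acts on it by zero. Denote by $R\text{-}{}^{t}\mathrm{Mod}$, $R\text{-}{}^{c}\mathrm{Mod}$, $R\text{-}{}^{0}\mathrm{Mod}$ the full subcategories of t-unital, c-unital and null-modules in $R\text{-}{}^{n}\mathrm{Mod}$. Let $R$ be a t-unital ring, i.e. the multiplication map $R\otimes_R R\to R$ is an isomorphism. (Then $R\text{-}{}^{0}\mathrm{Mod}$ is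 a Serre subcategory of $R\text{-}{}^{n}\mathrm{Mod}$, and $R\otimes_R M$ is t-unital and $\mathrm{Hom}_R(R,M)$ is c-unital for every left $R$-module $M$.) Let $R\text{-}{}^{n}\mathrm{Mod}/R\text{-}{}^{0}\mathrm{Mod}$ be the abelian Serre quotient category, i.e. the localization of $R\text{-}{}^{n}\mathrm{Mod}$ at the morphisms whose kernel and cokernel are null-modules. (a) The additive category $R\text{-}{}^{t}\mathrm{Mod}$ is abelian, and the functor $R\otimes_R{-}\colon R\text{-}{}^{n}\mathrm{Mod}\to R\text{-}{}^{t}\mathrm{Mod}$ is exact. This functor factorizes uniquely through the localization functor $R\text{-}{}^{n}\mathrm{Mod}\to R\text{-}{}^{n}\mathrm{Mod}/R\text{-}{}^{0}\mathrm{Mod}$, and the induced functor $R\text{-}{}^{n}\mathrm{Mod}/R\text{-}{}^{0}\mathrm{Mod}\to R\text{-}{}^{t}\mathrm{Mod}$ is an equivalence of abelian categories. The composition of the inclusion and localization functors $R\text{-}{}^{t}\mathrm{Mod}\to R\text{-}{}^{n}\mathrm{Mod}\to R\text{-}{}^{n}\mathrm{Mod}/R\text{-}{}^{0}\mathrm{Mod}$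 provides the inverse equivalence. (b) The additive category $R\text{-}{}^{c}\mathrm{Mod}$ is abelian, and the functor $\mathrm{Hom}_R(R,{-})\colon R\text{-}{}^{n}\mathrm{Mod}\to R\text{-}{}^{c}\mathrm{Mod}$ is exact. This functor factorizes uniquely through the localization functor $R\text{-}{}^{n}\mathrm{Mod}\to R\text{-}{}^{n}\mathrm{Mod}/R\text{-}{}^{0}\mathrm{Mod}$, and the induced functor $R\text{-}{}^{n}\mathrm{Mod}/R\text{-}{}^{0}\mathrm{Mod}\to R\text{-}{}^{c}\mathrm{Mod}$ is an equivalence of abelian categories. The composition of the inclusion and localization functors $R\text{-}{}^{c}\mathrm{Mod}\to R\text{-}{}^{n}\mathrm{Mod}\to R\text{-}{}^{n}\mathrm{Mod}/R\text{-}{}^{0}\mathrm{Mod}$ provides the inverse equivalence. -/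

import Mathlib

open CategoryTheory CategoryTheory.Limits
open scoped TensorProduct

universe u v

noncomputable section

namespace NU

/-! ### Nonunital left modules over nonunital associative rings -/

/-- A left module over a (possibly nonunital) associative ring: a biadditive associative action. -/
class NModule (R : Type u) (M : Type v) [NonUnitalRing R] [AddCommGroup M] extends SMul R M where
  smul_add (r : R) (x y : M) : r • (x + y) = r • x + r • y
  add_smul (r s : R) (x : M) : (r + s) • x = r • x + s • x
  mul_smul (r s : R) (x : M) : (r * s) • x = r • (s • x)

/-- The ring `R` as a left module over itself. -/
instance selfModule (R : Type u) [NonUnitalRing R] : NModule R R where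
  smul_add := mul_add
  add_smul := add_mul
  mul_smul := mul_assoc

section

variable (R : Type u) [NonUnitalRing R]

/-- The action as a biadditive map. -/
def act (M : Type v) [AddCommGroup M] [NModule R M] : R →+ M →+ M :=
  AddMonoidHom.mk' (fun r => AddMonoidHom.mk' (fun x => r • x) (NModule.smul_add r))
    (fun r s => by ext x; exact NModule.add_smul r s x)

variable {R} in
@[simp] lemma act_apply {M : Type v} [AddCommGroup M] [NModule R M] (r : R) (x : M) :
    act R M r x = r • x := rfl

variable {R} in
lemma nsmul_zero {M : Type v} [AddCommGroup M] [NModule R M] (r : R) : r • (0 : M) = 0 :=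
  (act R M r).map_zero

variable {R} in
lemma nzero_smul {M : Type v} [AddCommGroup M] [NModule R M] (x : M) : (0 : R) • x = 0 := by
  rw [← act_apply, map_zero, AddMonoidHom.zero_apply]

variable {R} in
lemma nzsmul_smul {M : Type v} [AddCommGroup M] [NModule R M] (n : ℤ) (r : R) (x : M) :
    (n • r) • x = n • (r • x) := by
  rw [← act_apply, map_zsmul, AddMonoidHom.zsmul_apply, act_apply]

variable {R} in
lemma nsmul_zsmul {M : Type v} [AddCommGroup M] [NModule R M] (n : ℤ) (r : R) (x : M) :
    r • (n • x) = n • (r • x) :=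
  map_zsmul (act R M r) n x

/-- The abelian group `Hom_R(L, M)` of additive maps commuting with the action of `R`. -/
def HomR (L M : Type*) [AddCommGroup L] [NModule R L] [AddCommGroup M] [NModule R M] :
    AddSubgroup (L →+ M) where
  carrier := {f | ∀ (r : R) (x : L), f (r • x) = r • f x}
  zero_mem' r x := (nsmul_zero r).symm
  add_mem' {f g} hf hg r x := by
    rw [AddMonoidHom.add_apply, AddMonoidHom.add_apply, hf r x, hg r x, NModule.smul_add]
  neg_mem' {f} hf r x := by
    rw [AddMonoidHom.neg_apply, AddMonoidHom.neg_apply, hf r x]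
    exact ((act R M r).map_neg (f x)).symm

/-- The category of nonunital left `R`-modules. -/
structure NMod where
  carrier : Type u
  [isAddCommGroup : AddCommGroup carrier]
  [isNModule : NModule R carrier]

attribute [instance] NMod.isAddCommGroup NMod.isNModule

instance : CoeSort (NMod R) (Type u) := ⟨NMod.carrier⟩

instance : Category (NMod R) where
  Hom L M := HomR R L M
  id L := ⟨AddMonoidHom.id L, fun _ _ => rfl⟩
  comp f g := ⟨g.1.comp f.1, fun r x => by
    rw [AddMonoidHom.comp_apply, AddMonoidHom.comp_apply, f.2 r x, g.2 r (f.1 x)]⟩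

variable {R} in
/-- The underlying additive map of a morphism. -/
def NMod.toAddHom {L M : NMod R} (f : L ⟶ M) : L →+ M := f.1

variable {R} in
lemma NMod.map_smul {L M : NMod R} (f : L ⟶ M) (r : R) (x : L) :
    NMod.toAddHom f (r • x) = r • NMod.toAddHom f x := f.2 r x

variable {R} in
@[ext] lemma NMod.hom_ext {L M : NMod R} {f g : L ⟶ M}
    (h : ∀ x, NMod.toAddHom f x = NMod.toAddHom g x) : f = g :=
  Subtype.ext (AddMonoidHom.ext h)

variable {R} in
@[simp] lemma NMod.id_apply {L : NMod R} (x : L) : NMod.toAddHom (𝟙 L) x = x := rfl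

variable {R} in
@[simp] lemma NMod.comp_apply {L M N : NMod R} (f : L ⟶ M) (g : M ⟶ N) (x : L) :
    NMod.toAddHom (f ≫ g) x = NMod.toAddHom g (NMod.toAddHom f x) := rfl

instance : Preadditive (NMod R) where
  homGroup L M := inferInstanceAs (AddCommGroup (HomR R L M))
  add_comp L M N f g h := by
    ext x; exact h.1.map_add (f.1 x) (g.1 x)
  comp_add L M N f g h := rfl

variable {R} in
@[simp] lemma NMod.add_apply {L M : NMod R} (f g : L ⟶ M) (x : L) :
    NMod.toAddHom (f + g) x = NMod.toAddHom f x + NMod.toAddHom g x := rfl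

variable {R} in
@[simp] lemma NMod.zero_apply {L M : NMod R} (x : L) :
    NMod.toAddHom (0 : L ⟶ M) x = 0 := rfl

/-! ### Comparison with unital modules over the unitalization, whence the category is abelian -/

/-- The unitalization `ℤ ⊕ R`. -/
def Unital : Type u := Unitization ℤ R

instance : Ring (Unital R) := inferInstanceAs (Ring (Unitization ℤ R))

variable {R} in
/-- The integer component. -/
def Unital.fst (a : Unital R) : ℤ := (show Unitization ℤ R from a).fst

variable {R} in
/-- The component in `R`. -/
def Unital.snd (a : Unital R) : R := (show Unitization ℤ R from a).snd

lemma Unital.fst_mul (a b : Unital R) : (a * b).fst = a.fst * b.fst := rfl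

lemma Unital.snd_mul (a b : Unital R) :
    (a * b).snd = a.fst • b.snd + b.fst • a.snd + a.snd * b.snd := rfl

lemma Unital.fst_add (a b : Unital R) : (a + b).fst = a.fst + b.fst := rfl

lemma Unital.snd_add (a b : Unital R) : (a + b).snd = a.snd + b.snd := rfl

/-- The inclusion of `R` into its unitalization. -/
def inrHom : R →ₙ+* Unital R where
  toFun r := (Unitization.inr r : Unitization ℤ R)
  map_zero' := Unitization.inr_zero ℤ
  map_add' := Unitization.inr_add ℤ
  map_mul' := Unitization.inr_mul ℤ

lemma Unital.eq_add (a : Unital R) : a = ((a.fst : ℤ) : Unital R) + inrHom R a.snd := by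
  have h : (Unitization.inl a.fst : Unitization ℤ R) = ((a.fst : ℤ) : Unitization ℤ R) :=
    map_intCast (Unitization.inlRingHom ℤ R) a.fst
  exact (Unitization.inl_fst_add_inr_snd_eq (a : Unitization ℤ R)).symm.trans
    (congrArg (fun z : Unitization ℤ R => z + (Unitization.inr a.snd : Unitization ℤ R)) h)

/-- A nonunital `R`-module as a unital module over `ℤ ⊕ R`. -/
@[reducible] def unitalModule (M : Type v) [AddCommGroup M] [NModule R M] :
    Module (Unital R) M where
  smul a x := a.fst • x + a.snd • x
  one_smul x := by
    change (1 : ℤ) • x + (0 : R) • x = x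
    rw [nzero_smul, one_smul, add_zero]
  mul_smul a b x := by
    change (a * b).fst • x + (a * b).snd • x
      = a.fst • (b.fst • x + b.snd • x) + a.snd • (b.fst • x + b.snd • x)
    rw [Unital.fst_mul, Unital.snd_mul, NModule.add_smul, NModule.add_smul,
      NModule.mul_smul, nzsmul_smul, nzsmul_smul, NModule.smul_add, nsmul_zsmul, smul_add,
      mul_smul]
    abel
  smul_zero a := by
    change a.fst • (0 : M) + a.snd • (0 : M) = 0
    rw [nsmul_zero, smul_zero, add_zero]
  smul_add a x y := by
    change a.fst • (x + y) + a.snd • (x + y) = (a.fst • x + a.snd • x) + (a.fst • y + a.snd • y)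
    rw [NModule.smul_add, smul_add]
    abel
  add_smul a b x := by
    change (a + b).fst • x + (a + b).snd • x
      = (a.fst • x + a.snd • x) + (b.fst • x + b.snd • x)
    rw [Unital.fst_add, Unital.snd_add, NModule.add_smul, add_smul]
    abel
  zero_smul x := by
    change (0 : ℤ) • x + (0 : R) • x = 0
    rw [nzero_smul, zero_smul, add_zero]

/-- The comparison functor from nonunital `R`-modules to unital `ℤ ⊕ R`-modules. -/
def toUnital : NMod R ⥤ ModuleCat.{u} (Unital R) where
  obj M := @ModuleCat.of (Unital R) _ M _ (unitalModule R M)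
  map {L M} f :=
    letI := unitalModule R L
    letI := unitalModule R M
    ModuleCat.ofHom
      { toFun := NMod.toAddHom f
        map_add' := (NMod.toAddHom f).map_add
        map_smul' := fun a x => by
          change NMod.toAddHom f (a.fst • x + a.snd • x)
            = a.fst • NMod.toAddHom f x + a.snd • NMod.toAddHom f x
          rw [map_add, map_zsmul, NMod.map_smul] }

lemma toUnital_map_apply {L M : NMod R} (f : L ⟶ M) (x : L) :
    ((toUnital R).map f).hom x = NMod.toAddHom f x := rfl

instance : (toUnital R).Additive where

instance : (toUnital R).Faithful where
  map_injective {L M f g} h := by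
    ext x
    rw [← toUnital_map_apply, h, toUnital_map_apply]

instance : (toUnital R).Full where
  map_surjective {L M} g := by
    refine ⟨⟨AddMonoidHom.mk' (fun x => g.hom x) (fun x y => map_add g.hom x y), ?_⟩, rfl⟩
    intro r x
    let y : M := g.hom x
    have h : g.hom ((0 : ℤ) • x + r • x : L) = ((0 : ℤ) • y + r • y : M) :=
      g.hom.map_smul (inrHom R r) x
    rwa [zero_smul, zero_smul, zero_add, zero_add] at h

/-- Restriction of scalars of a unital module along a nonunital ring homomorphism. -/
@[reducible] def restrictModule {A : Type u} [Ring A] (φ : R →ₙ+* A) (N : Type v) [AddCommGroup N]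
    [Module A N] : NModule R N where
  smul r x := φ r • x
  smul_add r x y := smul_add (φ r) x y
  add_smul r s x := by
    change φ (r + s) • x = φ r • x + φ s • x
    rw [map_add, add_smul]
  mul_smul r s x := by
    change φ (r * s) • x = φ r • φ s • x
    rw [map_mul, mul_smul]

lemma unital_decomp {N : Type v} [AddCommGroup N] [Module (Unital R) N]
    (a : Unital R) (x : N) : a.fst • x + inrHom R a.snd • x = a • x := by
  conv_rhs => rw [Unital.eq_add R a, add_smul, Int.cast_smul_eq_zsmul]

instance : (toUnital R).EssSurj where
  mem_essImage N := by
    let M : NMod R := @NMod.mk R _ N _ (restrictModule R (inrHom R) N)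
    let f : (toUnital R).obj M →ₗ[Unital R] N :=
      { toFun := fun x => x
        map_add' := fun _ _ => rfl
        map_smul' := fun a x => unital_decomp R (N := N) a x }
    exact ⟨M, ⟨(LinearEquiv.ofBijective f Function.bijective_id).toModuleIso⟩⟩

instance : (toUnital R).IsEquivalence where

instance : HasFiniteProducts (NMod R) where
  out _ := Adjunction.hasLimitsOfShape_of_equivalence (toUnital R)

/-- Nonunital modules form an abelian category. -/
instance : Abelian (NMod R) := abelianOfEquivalence (toUnital R)

variable {R} in
lemma NMod.injective_of_mono {L M : NMod R} (f : L ⟶ M) [Mono f] :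
    Function.Injective (NMod.toAddHom f) :=
  (ModuleCat.mono_iff_injective ((toUnital R).map f)).1 inferInstance

variable {R} in
lemma NMod.surjective_of_epi {L M : NMod R} (f : L ⟶ M) [Epi f] :
    Function.Surjective (NMod.toAddHom f) :=
  (ModuleCat.epi_iff_surjective ((toUnital R).map f)).1 inferInstance

variable {R} in
lemma NMod.exists_of_exact {S : ShortComplex (NMod R)} (hS : S.Exact) (x : S.X₂)
    (hx : NMod.toAddHom S.g x = 0) : ∃ y, NMod.toAddHom S.f y = x :=
  (ShortComplex.moduleCat_exact_iff _).1 (hS.map (toUnital R)) x hx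

/-! ### The tensor product `R ⊗_R M` and t-unital modules -/

section

variable (M : Type v) [AddCommGroup M] [NModule R M]

/-- The relations `ar ⊗ m = a ⊗ rm` defining `R ⊗_R M` as a quotient of `R ⊗_ℤ M`. -/
def tensorRel : Submodule ℤ (R ⊗[ℤ] M) :=
  Submodule.span ℤ {z | ∃ (a r : R) (m : M), z = (a * r) ⊗ₜ[ℤ] m - a ⊗ₜ[ℤ] (r • m)}

/-- The tensor product `R ⊗_R M` of the right `R`-module `R` and a left `R`-module `M`. -/
def RTensor : Type (max u v) := (R ⊗[ℤ] M) ⧸ tensorRel R M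

instance : AddCommGroup (RTensor R M) :=
  inferInstanceAs (AddCommGroup ((R ⊗[ℤ] M) ⧸ tensorRel R M))

variable {R M} in
/-- The class of `a ⊗ m` in `R ⊗_R M`. -/
def RTensor.tmul (a : R) (m : M) : RTensor R M := (tensorRel R M).mkQ (a ⊗ₜ[ℤ] m)

variable {M} in
lemma RTensor.mul_tmul (a r : R) (m : M) :
    (RTensor.tmul (a * r) m : RTensor R M) = RTensor.tmul a (r • m) :=
  (Submodule.Quotient.eq _).2 (Submodule.subset_span ⟨a, r, m, rfl⟩)

lemma RTensor.add_tmul (a b : R) (m : M) :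
    (RTensor.tmul (a + b) m : RTensor R M) = RTensor.tmul a m + RTensor.tmul b m := by
  unfold RTensor.tmul; rw [TensorProduct.add_tmul, map_add]; rfl

lemma RTensor.tmul_add (a : R) (m n : M) :
    (RTensor.tmul a (m + n) : RTensor R M) = RTensor.tmul a m + RTensor.tmul a n := by
  unfold RTensor.tmul; rw [TensorProduct.tmul_add, map_add]; rfl

variable {R M} in
lemma RTensor.induction {p : RTensor R M → Prop} (h0 : p 0)
    (ht : ∀ a m, p (RTensor.tmul a m)) (ha : ∀ x y, p x → p y → p (x + y)) (z) : p z := by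
  obtain ⟨z, rfl⟩ := (tensorRel R M).mkQ_surjective z
  induction z using TensorProduct.induction_on with
  | zero => rw [map_zero]; exact h0
  | tmul a m => exact ht a m
  | add x y hx hy => rw [map_add]; exact ha _ _ hx hy

variable {R M} in
lemma RTensor.addHom_ext {A : Type*} [AddCommGroup A] {f g : RTensor R M →+ A}
    (h : ∀ a m, f (RTensor.tmul a m) = g (RTensor.tmul a m)) : f = g := by
  ext z
  induction z using RTensor.induction with
  | h0 => rw [map_zero, map_zero]
  | ht a m => exact h a m
  | ha x y hx hy => rw [map_add, map_add, hx, hy]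

variable {R M} in
/-- The universal property: balanced biadditive maps induce additive maps out of `R ⊗_R M`. -/
def RTensor.lift {A : Type*} [AddCommGroup A] (φ : R →+ M →+ A)
    (h : ∀ (a r : R) (m : M), φ (a * r) m = φ a (r • m)) : RTensor R M →+ A :=
  ((tensorRel R M).liftQ
    (TensorProduct.liftAddHom φ (fun n a m => by
      rw [map_zsmul, map_zsmul, AddMonoidHom.zsmul_apply])).toIntLinearMap
    (by
      refine Submodule.span_le.2 ?_
      rintro _ ⟨a, r, m, rfl⟩
      rw [SetLike.mem_coe, LinearMap.mem_ker, AddMonoidHom.coe_toIntLinearMap,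
        map_sub, TensorProduct.liftAddHom_tmul, TensorProduct.liftAddHom_tmul, h,
        sub_self])).toAddMonoidHom

variable {R M} in
@[simp] lemma RTensor.lift_tmul {A : Type*} [AddCommGroup A] (φ : R →+ M →+ A)
    (h : ∀ (a r : R) (m : M), φ (a * r) m = φ a (r • m)) (a : R) (m : M) :
    RTensor.lift φ h (RTensor.tmul a m) = φ a m := rfl

/-- The biadditive map `(a, m) ↦ a ⊗ m`. -/
def RTensor.tmulHom : R →+ M →+ RTensor R M :=
  AddMonoidHom.mk' (fun a => AddMonoidHom.mk' (RTensor.tmul a) (RTensor.tmul_add R M a))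
    (fun a b => by ext m; exact RTensor.add_tmul R M a b m)

variable {R M} in
@[simp] lemma RTensor.tmulHom_apply (a : R) (m : M) :
    RTensor.tmulHom R M a m = RTensor.tmul a m := rfl

/-- Left multiplication `a ⊗ m ↦ ra ⊗ m` on `R ⊗_R M`. -/
def RTensor.leftMul (r : R) : RTensor R M →+ RTensor R M :=
  RTensor.lift ((RTensor.tmulHom R M).comp (AddMonoidHom.mulLeft r)) (fun a s m => by
    change RTensor.tmul (r * (a * s)) m = RTensor.tmul (r * a) (s • m)
    rw [← mul_assoc, RTensor.mul_tmul])

/-- The left `R`-module structure on `R ⊗_R M`, with `r (a ⊗ m) = ra ⊗ m`. -/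
instance : NModule R (RTensor R M) where
  smul r z := RTensor.leftMul R M r z
  smul_add r := (RTensor.leftMul R M r).map_add
  add_smul r s z := by
    change RTensor.leftMul R M (r + s) z = (RTensor.leftMul R M r + RTensor.leftMul R M s) z
    refine DFunLike.congr_fun (RTensor.addHom_ext fun a m => ?_) z
    change RTensor.tmul ((r + s) * a) m = RTensor.tmul (r * a) m + RTensor.tmul (s * a) m
    rw [add_mul, RTensor.add_tmul]
  mul_smul r s z := by
    change RTensor.leftMul R M (r * s) z
      = ((RTensor.leftMul R M r).comp (RTensor.leftMul R M s)) z
    refine DFunLike.congr_fun (RTensor.addHom_ext fun a m => ?_) z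
    change RTensor.tmul (r * s * a) m = RTensor.tmul (r * (s * a)) m
    rw [mul_assoc]

variable {M} in
@[simp] lemma RTensor.smul_tmul (r a : R) (m : M) :
    r • (RTensor.tmul a m : RTensor R M) = RTensor.tmul (r * a) m := rfl

/-- The natural map `R ⊗_R M → M`, `r ⊗ m ↦ rm`. -/
def tensorUnitality : HomR R (RTensor R M) M :=
  ⟨RTensor.lift (act R M) (fun a r m => NModule.mul_smul a r m), fun r z => by
    induction z using RTensor.induction with
    | h0 => rw [nsmul_zero, map_zero, nsmul_zero]
    | ht a m => exact NModule.mul_smul r a m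
    | ha x y hx hy => rw [NModule.smul_add, map_add, hx, hy, map_add, NModule.smul_add]⟩

variable {M} in
@[simp] lemma tensorUnitality_tmul (a : R) (m : M) :
    (tensorUnitality R M).1 (RTensor.tmul a m) = a • m := rfl

/-- A left `R`-module `M` is t-unital if the natural map `R ⊗_R M → M` is an isomorphism. -/
def IsTUnital : Prop := Function.Bijective (tensorUnitality R M).1

end

/-- A ring `R` is t-unital if the natural map `R ⊗_R R → R` is an isomorphism. -/
class IsTUnitalRing : Prop where
  isTUnital : IsTUnital R R

variable {R} in
/-- Functoriality of `R ⊗_R -`: the map `a ⊗ x ↦ a ⊗ f x`. -/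
def RTensor.map {L M : Type*} [AddCommGroup L] [NModule R L] [AddCommGroup M] [NModule R M]
    (f : HomR R L M) : HomR R (RTensor R L) (RTensor R M) :=
  ⟨RTensor.lift
    (AddMonoidHom.mk' (fun a => (RTensor.tmulHom R M a).comp f.1) (fun a b => by
      rw [map_add, AddMonoidHom.add_comp]))
    (fun a r x => by
      change RTensor.tmul (a * r) (f.1 x) = RTensor.tmul a (f.1 (r • x))
      rw [f.2 r x, RTensor.mul_tmul]),
  fun r z => by
    induction z using RTensor.induction with
    | h0 => rw [nsmul_zero, map_zero, nsmul_zero]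
    | ht a m => rfl
    | ha x y hx hy => rw [NModule.smul_add, map_add, hx, hy, map_add, NModule.smul_add]⟩

/-- The functor `R ⊗_R -` on nonunital left `R`-modules. -/
def tensorFunctor : NMod R ⥤ NMod R where
  obj M := NMod.mk (RTensor R M)
  map f := RTensor.map f
  map_id _ := Subtype.ext (RTensor.addHom_ext fun _ _ => rfl)
  map_comp _ _ := Subtype.ext (RTensor.addHom_ext fun _ _ => rfl)

/-! ### The module `Hom_R(R, P)` and c-unital modules -/

section

variable (P : Type v) [AddCommGroup P] [NModule R P]

/-- The left `R`-module structure on `Hom_R(R, P)`, with `(r f)(s) = f (s r)`. -/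
instance : NModule R (HomR R R P) where
  smul r f := ⟨f.1.comp (AddMonoidHom.mulRight r), fun s x => by
    change f.1 (s * x * r) = s • f.1 (x * r)
    rw [mul_assoc]; exact f.2 s (x * r)⟩
  smul_add r f g := rfl
  add_smul r s f := by
    refine Subtype.ext (AddMonoidHom.ext fun x => ?_)
    change f.1 (x * (r + s)) = f.1 (x * r) + f.1 (x * s)
    rw [mul_add, map_add]
  mul_smul r s f := by
    refine Subtype.ext (AddMonoidHom.ext fun x => ?_)
    change f.1 (x * (r * s)) = f.1 (x * r * s)
    rw [mul_assoc]

variable {R P} in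
lemma homR_smul_apply (r : R) (f : HomR R R P) (s : R) : (r • f).1 s = f.1 (s * r) := rfl

/-- The natural map `P → Hom_R(R, P)`, `p ↦ (r ↦ rp)`. -/
def homUnitality : HomR R P (HomR R R P) :=
  ⟨AddMonoidHom.mk' (fun p => ⟨(act R P).flip p, fun r s => NModule.mul_smul r s p⟩)
    (fun p q => Subtype.ext (map_add _ p q)),
  fun r p => Subtype.ext (AddMonoidHom.ext fun s => (NModule.mul_smul s r p).symm)⟩

variable {P} in
@[simp] lemma homUnitality_apply (p : P) (r : R) : ((homUnitality R P).1 p).1 r = r • p := rfl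

/-- A left `R`-module `P` is c-unital if the natural map `P → Hom_R(R, P)` is an isomorphism. -/
def IsCUnital : Prop := Function.Bijective (homUnitality R P).1

end

variable {R} in
/-- Functoriality of `Hom_R(R, -)`: composition with `f`. -/
def homMap {P Q : Type*} [AddCommGroup P] [NModule R P] [AddCommGroup Q] [NModule R Q]
    (f : HomR R P Q) : HomR R (HomR R R P) (HomR R R Q) :=
  ⟨AddMonoidHom.mk' (fun g => ⟨f.1.comp g.1, fun r x => by
      rw [AddMonoidHom.comp_apply, g.2, f.2, AddMonoidHom.comp_apply]⟩)
    (fun g h => Subtype.ext (AddMonoidHom.ext fun x => map_add f.1 (g.1 x) (h.1 x))),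
  fun _ _ => rfl⟩

/-- The functor `Hom_R(R, -)` on nonunital left `R`-modules. -/
def homFunctor : NMod R ⥤ NMod R where
  obj P := NMod.mk (HomR R R P)
  map f := homMap f
  map_id _ := rfl
  map_comp _ _ := rfl

/-! ### The full subcategories and the functors into them -/

/-- The property of being a t-unital module. -/
def tUnitalModules : ObjectProperty (NMod R) := fun M => IsTUnital R M

/-- The property of being a c-unital module. -/
def cUnitalModules : ObjectProperty (NMod R) := fun M => IsCUnital R M

/-- The property of being a null-module: `R` acts by zero. -/
def nullModules : ObjectProperty (NMod R) := fun M => ∀ (r : R) (x : M), r • x = 0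

/-- The full subcategory of t-unital left `R`-modules. -/
abbrev TMod := (tUnitalModules R).FullSubcategory

/-- The full subcategory of c-unital left `R`-modules. -/
abbrev CMod := (cUnitalModules R).FullSubcategory

section

variable [IsTUnitalRing R]

lemma tensorUnitality_bijective : Function.Bijective (tensorUnitality R R).1 :=
  IsTUnitalRing.isTUnital

/-- The inverse `R → R ⊗_R R` of the multiplication map. -/
def comul : R →+ RTensor R R :=
  (AddEquiv.ofBijective _ (tensorUnitality_bijective R)).symm.toAddMonoidHom

variable {R}

lemma tensorUnitality_comul (r : R) : (tensorUnitality R R).1 (comul R r) = r :=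
  (AddEquiv.ofBijective _ (tensorUnitality_bijective R)).apply_symm_apply r

lemma comul_mul (a b : R) : comul R (a * b) = RTensor.tmul a b :=
  (tensorUnitality_bijective R).1 (tensorUnitality_comul (a * b))

/-- A t-unital ring is idempotent: additive statements can be checked on products. -/
lemma mul_induction {p : R → Prop} (h0 : p 0) (hm : ∀ a b, p (a * b))
    (ha : ∀ x y, p x → p y → p (x + y)) (r : R) : p r := by
  rw [← tensorUnitality_comul r]
  induction comul R r using RTensor.induction with
  | h0 => rw [map_zero]; exact h0
  | ht a m => exact hm a m
  | ha x y hx hy => rw [map_add]; exact ha _ _ hx hy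

lemma addHom_ext_mul {A : Type*} [AddCommGroup A] {f g : R →+ A}
    (h : ∀ a b, f (a * b) = g (a * b)) : f = g := by
  ext r
  induction r using mul_induction with
  | h0 => rw [map_zero, map_zero]
  | hm a b => exact h a b
  | ha x y hx hy => rw [map_add, map_add, hx, hy]

/-- Over a t-unital ring, the module `R ⊗_R M` is t-unital. -/
lemma isTUnital_RTensor (M : Type v) [AddCommGroup M] [NModule R M] :
    IsTUnital R (RTensor R M) := by
  let φ : M →+ RTensor R R →+ RTensor R (RTensor R M) := AddMonoidHom.mk'
    (fun m => RTensor.lift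
      (AddMonoidHom.mk' (fun a => (RTensor.tmulHom R _ a).comp ((RTensor.tmulHom R M).flip m))
        (fun a b => by rw [map_add, AddMonoidHom.add_comp]))
      (fun a r b => by
        change RTensor.tmul (a * r) (RTensor.tmul b m) = RTensor.tmul a (RTensor.tmul (r * b) m)
        rw [RTensor.mul_tmul, RTensor.smul_tmul]))
    (fun m n => RTensor.addHom_ext fun a b => by
      change RTensor.tmul a (RTensor.tmul b (m + n))
        = RTensor.tmul a (RTensor.tmul b m) + RTensor.tmul a (RTensor.tmul b n)
      rw [RTensor.tmul_add, RTensor.tmul_add])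
  have hφ : ∀ m a b, φ m (RTensor.tmul a b) = RTensor.tmul a (RTensor.tmul b m) :=
    fun _ _ _ => rfl
  let ψ : RTensor R M →+ RTensor R (RTensor R M) := RTensor.lift (φ.flip.comp (comul R))
    (fun a r m => by
      change φ m (comul R (a * r)) = φ (r • m) (comul R a)
      rw [comul_mul, hφ]
      have key : (AddMonoidHom.mk' (fun a : R => RTensor.tmul a (RTensor.tmul r m))
          (fun a b => RTensor.add_tmul R _ a b _) : R →+ RTensor R (RTensor R M))
          = (φ (r • m)).comp (comul R) := addHom_ext_mul fun a b => by
        change RTensor.tmul (a * b) (RTensor.tmul r m) = φ (r • m) (comul R (a * b))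
        rw [comul_mul, hφ, RTensor.mul_tmul, RTensor.smul_tmul, RTensor.mul_tmul]
      exact DFunLike.congr_fun key a)
  have hψ : ∀ a b m, ψ (RTensor.tmul (a * b) m) = RTensor.tmul a (RTensor.tmul b m) := by
    intro a b m
    change φ m (comul R (a * b)) = _
    rw [comul_mul, hφ]
  have h1 : ψ.comp (tensorUnitality R (RTensor R M)).1 = AddMonoidHom.id _ := by
    refine RTensor.addHom_ext fun a z => ?_
    induction z using RTensor.induction with
    | h0 =>
      rw [show (RTensor.tmul a (0 : RTensor R M) : RTensor R (RTensor R M)) = 0 from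
        (RTensor.tmulHom R (RTensor R M) a).map_zero, map_zero, map_zero]
    | ht b m => exact hψ a b m
    | ha x y hx hy => rw [RTensor.tmul_add, map_add, map_add, hx, hy]
  refine ⟨fun x y hxy => ?_, fun z => ?_⟩
  · have := congrArg ψ hxy
    rwa [← AddMonoidHom.comp_apply, ← AddMonoidHom.comp_apply, h1] at this
  · induction z using RTensor.induction with
    | h0 => exact ⟨0, map_zero _⟩
    | ht a m =>
      induction a using mul_induction with
      | h0 => exact ⟨0, by rw [map_zero, ← RTensor.tmulHom_apply, map_zero]; rfl⟩
      | hm a b => exact ⟨RTensor.tmul a (RTensor.tmul b m), rfl⟩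
      | ha x y hx hy =>
        obtain ⟨z, hz⟩ := hx
        obtain ⟨w, hw⟩ := hy
        exact ⟨z + w, by rw [map_add, hz, hw, RTensor.add_tmul]⟩
    | ha x y hx hy =>
      obtain ⟨z, hz⟩ := hx
      obtain ⟨w, hw⟩ := hy
      exact ⟨z + w, by rw [map_add, hz, hw]⟩

/-- Over a t-unital ring, the module `Hom_R(R, P)` is c-unital. -/
lemma isCUnital_homR (P : Type v) [AddCommGroup P] [NModule R P] :
    IsCUnital R (HomR R R P) := by
  refine ⟨fun f g hfg => Subtype.ext (addHom_ext_mul fun a b => ?_), fun g => ?_⟩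
  · exact congrArg (fun h : HomR R R (HomR R R P) => (h.1 b).1 a) hfg
  · let φ : RTensor R R →+ P := RTensor.lift
      (AddMonoidHom.mk' (fun a => AddMonoidHom.mk' (fun b => (g.1 b).1 a) (fun b c => by
          rw [map_add]; rfl))
        (fun a b => by ext c; exact map_add (g.1 c).1 a b))
      (fun a r b => by
        change (g.1 b).1 (a * r) = (g.1 (r • b)).1 a
        rw [g.2 r b, homR_smul_apply])
    have hφ : ∀ a b, φ (comul R (a * b)) = (g.1 b).1 a := fun a b => by
      rw [comul_mul]; rfl
    refine ⟨⟨φ.comp (comul R), fun r s => ?_⟩, ?_⟩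
    · have key : (φ.comp (comul R)).comp (AddMonoidHom.mulLeft r)
          = (act R P r).comp (φ.comp (comul R)) := addHom_ext_mul fun a b => by
        change φ (comul R (r * (a * b))) = r • φ (comul R (a * b))
        rw [← mul_assoc, hφ, hφ]
        exact (g.1 b).2 r a
      exact DFunLike.congr_fun key s
    · exact Subtype.ext (AddMonoidHom.ext fun b => Subtype.ext (AddMonoidHom.ext fun a => hφ a b))

variable (R)

/-- The functor `R ⊗_R -` viewed as taking values in t-unital modules. -/
def tensorToTMod : NMod R ⥤ TMod R :=
  (tUnitalModules R).lift (tensorFunctor R) (fun M => isTUnital_RTensor M.carrier)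

/-- The functor `Hom_R(R, -)` viewed as taking values in c-unital modules. -/
def homToCMod : NMod R ⥤ CMod R :=
  (cUnitalModules R).lift (homFunctor R) (fun P => isCUnital_homR P.carrier)

/-! ### The Serre quotient by null-modules -/

/-- Over a t-unital ring the null-modules form a Serre subcategory. -/
instance : (nullModules R).IsSerreClass where
  exists_zero := ⟨@NMod.mk R _ PUnit _ {
      smul := fun _ x => x
      smul_add := fun _ _ _ => rfl
      add_smul := fun _ _ _ => rfl
      mul_smul := fun _ _ _ => rfl }, by
    rw [IsZero.iff_id_eq_zero]; rfl, fun _ _ => rfl⟩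
  prop_of_mono {X Y} f _ hY r x := NMod.injective_of_mono f (by
    rw [NMod.map_smul, hY, map_zero])
  prop_of_epi {X Y} f _ hX r y := by
    obtain ⟨x, rfl⟩ := NMod.surjective_of_epi f y
    rw [← NMod.map_smul, hX, map_zero]
  prop_X₂_of_shortExact {S} hS h₁ h₃ r x := by
    induction r using mul_induction with
    | h0 => exact nzero_smul x
    | hm a b =>
      obtain ⟨y, hy⟩ := NMod.exists_of_exact hS.exact (b • x) (by rw [NMod.map_smul, h₃])
      rw [NModule.mul_smul, ← hy, ← NMod.map_smul, h₁, map_zero]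
    | ha r s hr hs => rw [NModule.add_smul, hr, hs, add_zero]

/-- The Serre quotient category of nonunital left `R`-modules by the null-modules: the
localization at the morphisms whose kernel and cokernel are null-modules. -/
abbrev SerreQuotient := (nullModules R).isoModSerre.Localization

/-- The localization functor onto the Serre quotient. -/
abbrev quotientFunctor : NMod R ⥤ SerreQuotient R := (nullModules R).isoModSerre.Q

end

end

/-- A preadditive category is abelian, with its given preadditive structure. -/
def IsAbelianCategory (C : Type*) [Category* C] [P : Preadditive C] : Prop :=
  ∃ A : Abelian C, A.toPreadditive = P

end NU

end

namespace CategoryTheory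

section Exactness

variable {C D : Type*} [Category* C] [Category* D]

/-- A functor whose composite with a fully faithful functor preserves finite colimits itself
preserves finite colimits. -/
lemma preservesFiniteColimits_of_comp_fullyFaithful {E : Type*} [Category* E] (G : D ⥤ C)
    (F : C ⥤ E) [F.Full] [F.Faithful] [PreservesFiniteColimits (G ⋙ F)] :
    PreservesFiniteColimits G where
  preservesFiniteColimits _ _ _ :=
    have := fullyFaithful_reflectsColimits F
    preservesColimitsOfShape_of_reflects_of_preserves G F

/-- A functor whose composite with a fully faithful functor preserves finite limits itself
preserves finite limits. -/
lemma preservesFiniteLimits_of_comp_fullyFaithful {E : Type*} [Category* E] (G : D ⥤ C)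
    (F : C ⥤ E) [F.Full] [F.Faithful] [PreservesFiniteLimits (G ⋙ F)] :
    PreservesFiniteLimits G where
  preservesFiniteLimits _ _ _ :=
    have := fullyFaithful_reflectsLimits F
    preservesLimitsOfShape_of_reflects_of_preserves G F

variable [Preadditive C] [Abelian D]

/-- A reflective subcategory of an abelian category with left exact additive reflector is
abelian. -/
lemma isAbelianCategory_of_reflective (F : C ⥤ D) [F.Full] [F.Faithful] (G : D ⥤ C)
    [G.Additive] [PreservesFiniteLimits G] (adj : G ⊣ F) : NU.IsAbelianCategory C := by
  have i : F ⋙ G ≅ 𝟭 C := asIso adj.counit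
  have : G.EssSurj := ⟨fun X => ⟨F.obj X, ⟨i.app X⟩⟩⟩
  have := G.hasFiniteProducts_of_additive_of_essSurj
  exact ⟨abelianOfAdjunction F G i adj, rfl⟩

/-- A coreflective subcategory of an abelian category with right exact additive coreflector is
abelian. -/
lemma isAbelianCategory_of_coreflective (F : C ⥤ D) [F.Full] [F.Faithful] (G : D ⥤ C)
    [G.Additive] [PreservesFiniteColimits G] (adj : F ⊣ G) : NU.IsAbelianCategory C := by
  have i : F ⋙ G ≅ 𝟭 C := (asIso adj.unit).symm
  have : G.EssSurj := ⟨fun X => ⟨F.obj X, ⟨i.app X⟩⟩⟩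
  have := G.hasFiniteProducts_of_additive_of_essSurj
  have : PreservesFiniteLimits G.op := preservesFiniteLimits_op G
  obtain ⟨A, -⟩ := isAbelianCategory_of_reflective F.op G.op adj.op
  have : HasFiniteProducts Cᵒᵖᵒᵖ :=
    ⟨fun _ => Adjunction.hasLimitsOfShape_of_equivalence (opOpEquivalence C).functor⟩
  exact ⟨abelianOfEquivalence (opOpEquivalence C).inverse, rfl⟩

end Exactness

/-- The equivalence between the Serre quotient of `C` by `P` and a category `A`,
induced by an exact functor `G : C ⥤ A` with kernel `P` which is a localization functor at the
morphisms it inverts. -/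
theorem serreQuotient_equivalence {C A : Type*} [Category* C] [Abelian C] [Category* A]
    [Preadditive A] (P : ObjectProperty C) [P.IsSerreClass] (hA : NU.IsAbelianCategory A)
    (ι : A ⥤ C) (G : C ⥤ A) [G.Additive] (hG : exactFunctor _ _ G)
    [G.IsLocalization ((MorphismProperty.isomorphisms A).inverseImage G)]
    (i : ι ⋙ G ≅ 𝟭 A) (hP : ∀ X, IsZero (G.obj X) ↔ P X) :
    ∃ F : P.isoModSerre.Localization ⥤ A,
      (P.isoModSerre.Q ⋙ F = G ∧
        ∀ F' : P.isoModSerre.Localization ⥤ A, P.isoModSerre.Q ⋙ F' = G → F' = F) ∧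
      NU.IsAbelianCategory P.isoModSerre.Localization ∧ F.Additive ∧ exactFunctor _ _ F ∧
      ∃ e : P.isoModSerre.Localization ≌ A,
        e.functor = F ∧ e.inverse = ι ⋙ P.isoModSerre.Q := by
  obtain ⟨A', rfl⟩ := hA
  have : PreservesFiniteLimits G := hG.1
  have : PreservesFiniteColimits G := hG.2
  obtain rfl : G.kernel = P := by
    ext X
    exact hP X
  have hW := Abelian.isoModSerre_kernel_eq_inverseImage_isomorphisms G
  have : G.IsLocalization G.kernel.isoModSerre := by rwa [hW]
  have hinv : G.kernel.isoModSerre.IsInvertedBy G := Localization.inverts G _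
  let F := Localization.Construction.lift G hinv
  have hF : G.kernel.isoModSerre.Q ⋙ F = G := Localization.Construction.fac G hinv
  have hFe : F.IsEquivalence :=
    inferInstanceAs (Localization.Construction.lift G (Localization.inverts G _)).IsEquivalence
  refine ⟨F, ⟨hF, fun F' h => Localization.Construction.uniq _ _ (h.trans hF.symm)⟩,
    ⟨ObjectProperty.SerreClassLocalization.abelian G.kernel.isoModSerre.Q G.kernel, rfl⟩,
    ?_, ?_, ?_⟩
  · rw [Localization.functor_additive_iff G.kernel.isoModSerre.Q G.kernel.isoModSerre, hF]
    infer_instance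
  · exact ⟨inferInstanceAs (PreservesFiniteLimits F), inferInstanceAs (PreservesFiniteColimits F)⟩
  · let j : (ι ⋙ G.kernel.isoModSerre.Q) ⋙ F ≅ 𝟭 A :=
      Functor.isoWhiskerLeft ι (eqToIso hF) ≪≫ i
    let k : F.asEquivalence.inverse ≅ ι ⋙ G.kernel.isoModSerre.Q :=
      Functor.isoWhiskerRight j.symm F.asEquivalence.inverse ≪≫
        Functor.isoWhiskerLeft (ι ⋙ G.kernel.isoModSerre.Q) F.asEquivalence.unitIso.symm
    exact ⟨F.asEquivalence.changeInverse k, rfl, rfl⟩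

end CategoryTheory

namespace NU

variable {R : Type u} [NonUnitalRing R]

/-- A bijective morphism of nonunital modules is an isomorphism. -/
lemma NMod.isIso_of_bijective {L M : NMod R} (f : L ⟶ M)
    (hf : Function.Bijective (NMod.toAddHom f)) : IsIso f := by
  let e := AddEquiv.ofBijective (NMod.toAddHom f) hf
  have he : ∀ y, NMod.toAddHom f (e.symm y) = y := e.apply_symm_apply
  refine ⟨⟨e.symm.toAddMonoidHom, fun r y => hf.1 ?_⟩, NMod.hom_ext fun x => ?_,
    NMod.hom_ext fun y => ?_⟩
  · change NMod.toAddHom f (e.symm (r • y)) = NMod.toAddHom f (r • e.symm y)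
    rw [NMod.map_smul, he, he]
  · exact e.symm_apply_apply x
  · exact he y

lemma NMod.isZero_iff {M : NMod R} : IsZero M ↔ ∀ x : M, x = 0 := by
  rw [IsZero.iff_id_eq_zero]
  exact ⟨fun h x => congrArg (fun f => NMod.toAddHom f x) h, fun h => NMod.hom_ext fun x => h x⟩

lemma isZero_fullSubcategory_iff {P : ObjectProperty (NMod R)} (M : P.FullSubcategory) :
    IsZero M ↔ ∀ x : M.obj, x = 0 := by
  rw [← NMod.isZero_iff, IsZero.iff_id_eq_zero, IsZero.iff_id_eq_zero]
  exact ⟨fun h => congrArg (fun f => f.hom) h, fun h => by ext1; exact h⟩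

variable (R)

/-- The natural map `R ⊗_R M → M` as a natural transformation. -/
noncomputable def tensorUnitalityNat : tensorFunctor R ⟶ 𝟭 (NMod R) where
  app M := tensorUnitality R M
  naturality _ _ f := Subtype.ext (RTensor.addHom_ext fun a x => (NMod.map_smul f a x).symm)

/-- The natural map `P → Hom_R(R, P)` as a natural transformation. -/
noncomputable def homUnitalityNat : 𝟭 (NMod R) ⟶ homFunctor R where
  app P := homUnitality R P
  naturality _ _ f := NMod.hom_ext fun p => Subtype.ext (AddMonoidHom.ext fun r =>
    (NMod.map_smul f r p).symm)

/-- The unit `M → Hom_R(R, R ⊗_R M)`. -/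
noncomputable def tensorHomUnit : 𝟭 (NMod R) ⟶ tensorFunctor R ⋙ homFunctor R where
  app M := (⟨AddMonoidHom.mk' (fun m => ⟨(RTensor.tmulHom R M).flip m, fun _ _ => rfl⟩)
    fun m n => Subtype.ext (map_add (RTensor.tmulHom R M).flip m n),
    fun r m => Subtype.ext (AddMonoidHom.ext fun s => (RTensor.mul_tmul R s r m).symm)⟩ :
    HomR R M (HomR R R (RTensor R M)))
  naturality _ _ _ := rfl

/-- The counit `R ⊗_R Hom_R(R, P) → P`. -/
noncomputable def tensorHomCounit : homFunctor R ⋙ tensorFunctor R ⟶ 𝟭 (NMod R) where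
  app P := (⟨RTensor.lift (M := HomR R R P) ((HomR R R P).subtype.flip) fun a r f => rfl,
    fun r z => by
      induction z using RTensor.induction with
      | h0 => rw [nsmul_zero, map_zero, nsmul_zero]
      | ht a f => exact f.2 r a
      | ha x y hx hy => rw [NModule.smul_add, map_add, hx, hy, map_add, NModule.smul_add]⟩ :
    HomR R (RTensor R (HomR R R P)) P)
  naturality _ _ _ := Subtype.ext (RTensor.addHom_ext fun _ _ => rfl)

/-- The tensor-hom adjunction. -/
noncomputable def tensorHomAdjunction : tensorFunctor R ⊣ homFunctor R where
  unit := tensorHomUnit R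
  counit := tensorHomCounit R
  left_triangle_components _ := Subtype.ext (RTensor.addHom_ext fun _ _ => rfl)
  right_triangle_components _ := rfl

instance : (tensorFunctor R).Additive where
  map_add {_ M f g} := Subtype.ext (RTensor.addHom_ext fun a x =>
    RTensor.tmul_add R M a (NMod.toAddHom f x) (NMod.toAddHom g x))

variable {R} in
/-- The natural isomorphism `R ⊗_R M ≅ M` for a t-unital module `M`. -/
noncomputable def tensorUnitalityIso {M : NMod R} (hM : tUnitalModules R M) :
    (tensorFunctor R).obj M ≅ M :=
  @asIso _ _ _ _ ((tensorUnitalityNat R).app M) (NMod.isIso_of_bijective _ hM)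

variable {R} in
/-- The natural isomorphism `P ≅ Hom_R(R, P)` for a c-unital module `P`. -/
noncomputable def homUnitalityIso {P : NMod R} (hP : cUnitalModules R P) :
    P ≅ (homFunctor R).obj P :=
  @asIso _ _ _ _ ((homUnitalityNat R).app P) (NMod.isIso_of_bijective _ hP)

variable {R} in
lemma RTensor.tmul_tensorUnitality {M : Type v} [AddCommGroup M] [NModule R M] (a : R)
    (z : RTensor R M) : RTensor.tmul a ((tensorUnitality R M).1 z) = a • z := by
  induction z using RTensor.induction with
  | h0 => rw [map_zero, nsmul_zero]; exact map_zero (RTensor.tmulHom R M a)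
  | ht b m => exact (RTensor.mul_tmul R a b m).symm
  | ha x y hx hy => rw [map_add, RTensor.tmul_add, hx, hy, NModule.smul_add]

lemma tensorFunctor_map_tensorUnitality (M : NMod R) :
    (tensorFunctor R).map ((tensorUnitalityNat R).app M)
      = (tensorUnitalityNat R).app ((tensorFunctor R).obj M) :=
  Subtype.ext (RTensor.addHom_ext fun a z => RTensor.tmul_tensorUnitality a z)

lemma homFunctor_map_homUnitality (P : NMod R) :
    (homFunctor R).map ((homUnitalityNat R).app P)
      = (homUnitalityNat R).app ((homFunctor R).obj P) := by
  refine NMod.hom_ext fun f => Subtype.ext (AddMonoidHom.ext fun r =>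
    Subtype.ext (AddMonoidHom.ext fun s => ?_))
  exact (f.2 s r).symm

variable [IsTUnitalRing R]

/-- The t-unital modules are coreflective in all modules, with coreflector `R ⊗_R -`. -/
noncomputable def tensorCoreflection : (tUnitalModules R).ι ⊣ tensorToTMod R where
  unit :=
    { app := fun M => (tUnitalModules R).homMk (tensorUnitalityIso M.property).inv
      naturality := fun L M f => by
        ext1
        change f.hom ≫ (tensorUnitalityIso M.property).inv
          = (tensorUnitalityIso L.property).inv ≫ (tensorFunctor R).map f.hom
        rw [Iso.comp_inv_eq, Category.assoc, Iso.eq_inv_comp]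
        exact ((tensorUnitalityNat R).naturality f.hom).symm }
  counit := tensorUnitalityNat R
  left_triangle_components M := (tensorUnitalityIso M.property).inv_hom_id
  right_triangle_components M := by
    ext1
    let i : (tensorFunctor R).obj ((tensorFunctor R).obj M) ≅ (tensorFunctor R).obj M :=
      tensorUnitalityIso ((tensorToTMod R).obj M).property
    exact (congrArg (i.inv ≫ ·) (tensorFunctor_map_tensorUnitality R M)).trans i.inv_hom_id

/-- The c-unital modules are reflective in all modules, with reflector `Hom_R(R, -)`. -/
noncomputable def homReflection : homToCMod R ⊣ (cUnitalModules R).ι where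
  unit := homUnitalityNat R
  counit :=
    { app := fun P => (cUnitalModules R).homMk (homUnitalityIso P.property).inv
      naturality := fun P Q f => by
        ext1
        change (homFunctor R).map f.hom ≫ (homUnitalityIso Q.property).inv
          = (homUnitalityIso P.property).inv ≫ f.hom
        rw [Iso.comp_inv_eq, Category.assoc, Iso.eq_inv_comp]
        exact ((homUnitalityNat R).naturality f.hom).symm }
  left_triangle_components P := by
    ext1
    let i : (homFunctor R).obj P ≅ (homFunctor R).obj ((homFunctor R).obj P) :=
      homUnitalityIso ((homToCMod R).obj P).property
    exact (congrArg (· ≫ i.inv) (homFunctor_map_homUnitality R P)).trans i.hom_inv_id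
  right_triangle_components P := (homUnitalityIso P.property).hom_inv_id

instance : (tensorToTMod R).Additive where
  map_add := by
    intros
    ext1
    exact (tensorFunctor R).map_add

instance : (homToCMod R).Additive where

lemma exactFunctor_tensorToTMod : exactFunctor _ _ (tensorToTMod R) := by
  have : PreservesColimits (tensorFunctor R) :=
    (tensorHomAdjunction R).leftAdjoint_preservesColimits
  have : PreservesLimits (tensorToTMod R) := (tensorCoreflection R).rightAdjoint_preservesLimits
  have : PreservesFiniteColimits (tensorToTMod R ⋙ (tUnitalModules R).ι) :=
    inferInstanceAs (PreservesFiniteColimits (tensorFunctor R))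
  exact ⟨inferInstanceAs (PreservesFiniteLimits (tensorToTMod R)),
    preservesFiniteColimits_of_comp_fullyFaithful _ (tUnitalModules R).ι⟩

lemma exactFunctor_homToCMod : exactFunctor _ _ (homToCMod R) := by
  have : PreservesLimits (homFunctor R) :=
    (tensorHomAdjunction R).rightAdjoint_preservesLimits
  have : PreservesColimits (homToCMod R) := (homReflection R).leftAdjoint_preservesColimits
  have : PreservesFiniteLimits (homToCMod R ⋙ (cUnitalModules R).ι) :=
    inferInstanceAs (PreservesFiniteLimits (homFunctor R))
  exact ⟨preservesFiniteLimits_of_comp_fullyFaithful _ (cUnitalModules R).ι,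
    inferInstanceAs (PreservesFiniteColimits (homToCMod R))⟩

variable {R}

lemma isZero_tensorToTMod_obj_iff (M : NMod R) :
    IsZero ((tensorToTMod R).obj M) ↔ nullModules R M := by
  rw [isZero_fullSubcategory_iff]
  change (∀ z : RTensor R M, z = 0) ↔ _
  refine ⟨fun h r x => ?_, fun h z => ?_⟩
  · rw [← tensorUnitality_tmul, h (RTensor.tmul r x), map_zero]
  · induction z using RTensor.induction with
    | h0 => rfl
    | ht a m =>
      change RTensor.tmulHom R M a m = 0
      induction a using mul_induction with
      | h0 => rw [map_zero, AddMonoidHom.zero_apply]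
      | hm a b => rw [RTensor.tmulHom_apply, RTensor.mul_tmul, h, ← RTensor.tmulHom_apply, map_zero]
      | ha x y hx hy => rw [map_add, AddMonoidHom.add_apply, hx, hy, add_zero]
    | ha x y hx hy => rw [hx, hy, add_zero]

lemma isZero_homToCMod_obj_iff (P : NMod R) :
    IsZero ((homToCMod R).obj P) ↔ nullModules R P := by
  rw [isZero_fullSubcategory_iff]
  change (∀ f : HomR R R P, f = 0) ↔ _
  refine ⟨fun h r p => ?_, fun h f => Subtype.ext (addHom_ext_mul fun a b => ?_)⟩
  · rw [← homUnitality_apply, h ((homUnitality R P).1 p)]; rfl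
  · exact (f.2 a b).trans (h _ _)

end NU

theorem theorem5p9 (R : Type u) [NonUnitalRing R] [NU.IsTUnitalRing R] :
    -- (a) t-unital modules
    (NU.IsAbelianCategory (NU.TMod R) ∧
      (NU.tensorToTMod R).Additive ∧ exactFunctor _ _ (NU.tensorToTMod R) ∧
      ∃ F : NU.SerreQuotient R ⥤ NU.TMod R,
        (NU.quotientFunctor R ⋙ F = NU.tensorToTMod R ∧
          ∀ G : NU.SerreQuotient R ⥤ NU.TMod R,
            NU.quotientFunctor R ⋙ G = NU.tensorToTMod R → G = F) ∧
        NU.IsAbelianCategory (NU.SerreQuotient R) ∧ F.Additive ∧ exactFunctor _ _ F ∧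
        ∃ e : NU.SerreQuotient R ≌ NU.TMod R,
          e.functor = F ∧ e.inverse = (NU.tUnitalModules R).ι ⋙ NU.quotientFunctor R) ∧
    -- (b) c-unital modules
    (NU.IsAbelianCategory (NU.CMod R) ∧
      (NU.homToCMod R).Additive ∧ exactFunctor _ _ (NU.homToCMod R) ∧
      ∃ F : NU.SerreQuotient R ⥤ NU.CMod R,
        (NU.quotientFunctor R ⋙ F = NU.homToCMod R ∧
          ∀ G : NU.SerreQuotient R ⥤ NU.CMod R,
            NU.quotientFunctor R ⋙ G = NU.homToCMod R → G = F) ∧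
        NU.IsAbelianCategory (NU.SerreQuotient R) ∧ F.Additive ∧ exactFunctor _ _ F ∧
        ∃ e : NU.SerreQuotient R ≌ NU.CMod R,
          e.functor = F ∧ e.inverse = (NU.cUnitalModules R).ι ⋙ NU.quotientFunctor R) := by
  constructor
  · have hG := NU.exactFunctor_tensorToTMod R
    have : PreservesFiniteColimits (NU.tensorToTMod R) := hG.2
    have hA := isAbelianCategory_of_coreflective _ _ (NU.tensorCoreflection R)
    have := (NU.tensorCoreflection R).isLocalization'
    exact ⟨hA, inferInstance, hG, serreQuotient_equivalence (NU.nullModules R) hA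
      (NU.tUnitalModules R).ι (NU.tensorToTMod R) hG (asIso (NU.tensorCoreflection R).unit).symm
      NU.isZero_tensorToTMod_obj_iff⟩
  · have hG := NU.exactFunctor_homToCMod R
    have : PreservesFiniteLimits (NU.homToCMod R) := hG.1
    have hA := isAbelianCategory_of_reflective _ _ (NU.homReflection R)
    have := (NU.homReflection R).isLocalization
    exact ⟨hA, inferInstance, hG, serreQuotient_equivalence (NU.nullModules R) hA
      (NU.cUnitalModules R).ι (NU.homToCMod R) hG (asIso (NU.homReflection R).counit)
      NU.isZero_homToCMod_obj_iff⟩
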